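/- Let $M$ be a smooth Hausdorff manifold without boundary, let $E\to M$ be a Lie algebroid (a smooth real vector bundle of finite rank with a Lie bracket on its smooth sections and a smooth bundle map $\rho:E\to TM$, the anchor, such that $[u,fv]=\rho(u)[f]\,v+f[u,v]$), and let $G=\langle\cdot|\cdot\rangle$ be a Riemannian metric on $E$. Let $\nabla$ be the Levi-Civita connection of $(E,G)$, i.e. the $E$-connection on $E$ that satisfies $\nabla_uv-\nabla_vu=[u,v]$ and $\rho(u)\langle v|w\rangle=\langle\nabla_uv|w\rangle+\langle v|\nabla_uw\rangle$, and let $R(u,v)w=\nabla_u\nabla_vw-\nabla_v\nabla_uw-\nabla_{[u,v]}w$. A smooth section $u$ is a Killing section if $\mathcal L_uG=0$, i.e. $\rho(u)\langle v|w\rangle=\langle[u,v]|w\rangle+\langle v|[u,w]\rangle$ for all smooth sections $v,w$. For a section $u$ put $L^u(a,b)=\langle\nabla_au|b\rangle$, in a local basis of sections $L_{ab}=(\nabla_au)^cG_{cb}$. An admissible curve is a continuous curve $t\mapsto v(t)\in E_{x(t)}$, $t\in[0,1]$, over a differentiable base curve $x(t)$ in $M$ with $\dot x(t)=\rho(v(t))$.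 For a curve of vectors $U(t)\in E_{x(t)}$ and a curve of bilinear forms $\Lambda(t)$ on $E_{x(t)}$ consider the first-order system $$\langle\nabla_{v}U\,|\,a\rangle=\Lambda(v,a),\qquad (\nabla_{v}\Lambda)(c,a)=-\langle R(c,a)U\,|\,v\rangle\qquad\text{for all }t\in[0,1],\ a,c\in E_{x(t)},\qquad(*)$$ where $\nabla_v$ is the covariant derivative along the admissible curve. In a local basis $(s_a)$, with $R(s_b,s_c)s_a=R_{a}{}^{d}{}_{bc}s_d$, the right-hand sides are $v^b\Lambda_{ba}$ and $-v^bU^eR_e{}^d{}_{ca}G_{db}$. Then: 1. If $u$ is a Killing section, then $L^u$ is antisymmetric at every point of $M$. 2. The system $(*)$ is linear: linear combinations with constant real coefficients of solutions along a given admissible curve are solutions. 3. If $u$ is a Killing section, then along every admissible curve the pair $U(t)=u(x(t))$, $\Lambda(t)=L^u(x(t))$ solves $(*)$, and every solution $(U,\Lambda)$ of $(*)$ along this curve with $U(0)=u(x(0))$ and $\Lambda(0)=L^u(x(0))$ satisfies $U(t)=u(x(t))$ and $\Lambda(t)=L^u(x(t))$ for all $t\in[0,1]$. 4. If $u,u'$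 are Killing sections and $p\in M$ is a point with $u(p)=u'(p)$ and $L^u(p)=L^{u'}(p)$, then $u(q)=u'(q)$ and $L^u(q)=L^{u'}(q)$ for every $q\in M$ that is joined to $p$ by the base curve of an admissible curve starting over $p$ and ending over $q$. In particular, if every point of $M$ is joined to $p$ in this way, then $u=u'$. -/

import Mathlib

open Bundle Set Filter Topology
open scoped Manifold ContDiff

/-! # Riemannian Lie algebroids over a smooth manifold

`M` is a smooth Hausdorff manifold of dimension `m` without boundary, and `E` is a smooth real
vector bundle over `M` with a finite-dimensional fibre model `F`. -/

noncomputable section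

section LieAlgebroids

variable {m : ℕ} {M : Type*} [TopologicalSpace M] [T2Space M]
  [ChartedSpace (EuclideanSpace ℝ (Fin m)) M] [IsManifold (𝓡 m) ∞ M]
  {F : Type*} [NormedAddCommGroup F] [NormedSpace ℝ F]
  {E : M → Type*} [∀ x, AddCommGroup (E x)] [∀ x, Module ℝ (E x)]
  [∀ x, TopologicalSpace (E x)] [TopologicalSpace (TotalSpace F E)]
  [FiberBundle F E] [VectorBundle ℝ F E] [ContMDiffVectorBundle ∞ F E (𝓡 m)]

/-- The product `f u` of a smooth function and a smooth section. -/
def smulSection (f : C^∞⟮𝓡 m, M; ℝ⟯) (u : Cₛ^∞⟮𝓡 m; F, E⟯) : Cₛ^∞⟮𝓡 m; F, E⟯ :=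
  ⟨fun x => f x • u x, f.contMDiff.smul_section u.contMDiff⟩

/-- Every vector `a ∈ E_x` is the value at `x` of a global smooth section. -/
theorem exists_smoothSection_eq {x : M} (a : E x) :
    ∃ s : Cₛ^∞⟮𝓡 m; F, E⟯, s x = a := by
  obtain ⟨N, hN, hs⟩ := FiberBundle.exists_contMDiffOn_extend (k := ∞) (𝓡 m) F a
  obtain ⟨N', hN', hopen, hx⟩ := mem_nhds_iff.1 hN
  obtain ⟨f, hf, -⟩ := (SmoothBumpFunction.nhds_basis_support (I := 𝓡 m)
    (hopen.mem_nhds hx)).mem_iff.1 (hopen.mem_nhds hx)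
  refine ⟨⟨(f : M → ℝ) • FiberBundle.extend F a, ?_⟩, ?_⟩
  · exact ContMDiffOn.smul_section_of_tsupport f.contMDiff.contMDiffOn hopen hf (hs.mono hN')
  · show f x • FiberBundle.extend F a x = a
    simp

variable [FiniteDimensional ℝ F] [∀ x, IsTopologicalAddGroup (E x)]
  [∀ x, ContinuousConstSMul ℝ (E x)]

variable (m M F E) in
/-- A Lie algebroid structure on the vector bundle `E → M`: a real Lie algebra structure on the
smooth sections and an anchor, a smooth bundle map `E → TM`, subject to the Leibniz rule
`[u, f v] = ρ(u)[f] v + f [u, v]`. -/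
structure LieAlgebroid where
  bracket : Cₛ^∞⟮𝓡 m; F, E⟯ → Cₛ^∞⟮𝓡 m; F, E⟯ → Cₛ^∞⟮𝓡 m; F, E⟯
  anchor : ∀ x : M, E x →ₗ[ℝ] TangentSpace (𝓡 m) x
  bracket_add : ∀ u v w, bracket u (v + w) = bracket u v + bracket u w
  bracket_smul : ∀ (c : ℝ) (u v), bracket u (c • v) = c • bracket u v
  bracket_skew : ∀ u v, bracket u v = - bracket v u
  jacobi : ∀ u v w,
    bracket u (bracket v w) + bracket v (bracket w u) + bracket w (bracket u v) = 0
  contMDiff_anchor : ∀ u : Cₛ^∞⟮𝓡 m; F, E⟯,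
    ContMDiff (𝓡 m) (𝓡 m).tangent ∞ (fun x => (⟨x, anchor x (u x)⟩ : TangentBundle (𝓡 m) M))
  leibniz : ∀ (f : C^∞⟮𝓡 m, M; ℝ⟯) (u v) (x : M),
    bracket u (smulSection f v) x =
      mvfderiv (𝓡 m) f x (anchor x (u x)) • v x + f x • bracket u v x

namespace LieAlgebroid

variable (A : LieAlgebroid m M F E)

/-- The derivative `ρ(a)[f]` at `x` of a function `f` along the anchor image of `a ∈ E_x`. -/
def deriv (f : M → ℝ) (x : M) (a : E x) : ℝ :=
  mvfderiv (𝓡 m) f x (A.anchor x a)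

/-- The Lie derivative of the metric along `u`, evaluated on two sections:
`(L_u G)(v, w) = ρ(u)⟨v|w⟩ - ⟨[u, v]|w⟩ - ⟨v|[u, w]⟩`. -/
def lieDerivMetric (G : ContMDiffRiemannianMetric (𝓡 m) ∞ F E)
    (u v w : Cₛ^∞⟮𝓡 m; F, E⟯) (x : M) : ℝ :=
  A.deriv (fun y => G.inner y (v y) (w y)) x (u x)
    - G.inner x (A.bracket u v x) (w x) - G.inner x (v x) (A.bracket u w x)

/-- `u` is a Killing section of `(E, G)`: the Lie derivative of `G` along `u` vanishes. -/
def IsKilling (G : ContMDiffRiemannianMetric (𝓡 m) ∞ F E) (u : Cₛ^∞⟮𝓡 m; F, E⟯) : Prop :=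
  ∀ (v w : Cₛ^∞⟮𝓡 m; F, E⟯) (x : M), A.lieDerivMetric G u v w x = 0

/-- A Lie algebroid connection; `D u x a` is `(∇_a u)(x)` for `a ∈ E_x`. The rule
`∇_{f v} u = f ∇_v u` is expressed by `(∇_a u)(x)` being linear in the vector `a ∈ E_x`. -/
structure Connection where
  D : Cₛ^∞⟮𝓡 m; F, E⟯ → ∀ x : M, E x →ₗ[ℝ] E x
  contMDiff_D : ∀ u v : Cₛ^∞⟮𝓡 m; F, E⟯,
    ContMDiff (𝓡 m) ((𝓡 m).prod 𝓘(ℝ, F)) ∞ (fun x => TotalSpace.mk' F x (D u x (v x)))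
  D_add : ∀ (u v) (x : M) (a : E x), D (u + v) x a = D u x a + D v x a
  D_leibniz : ∀ (f : C^∞⟮𝓡 m, M; ℝ⟯) (u) (x : M) (a : E x),
    D (smulSection f u) x a = f x • D u x a + A.deriv f x a • u x

/-- An admissible curve `[0, 1] → E`: a continuous curve `t ↦ v(t)` in `E` over a differentiable
base curve `x(t)` in `M` such that `ẋ(t) = ρ(v(t))`. The values outside `[0, 1]` are irrelevant. -/
structure AdmissibleCurve where
  base : ℝ → M
  vel : ∀ t, E (base t)
  continuousOn : ContinuousOn (fun t => TotalSpace.mk' F (base t) (vel t)) (Icc 0 1)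
  hasMFDerivWithinAt : ∀ t ∈ Icc (0 : ℝ) 1,
    HasMFDerivWithinAt 𝓘(ℝ, ℝ) (𝓡 m) base (Icc 0 1) t
      ((1 : ℝ →L[ℝ] ℝ).smulRight (A.anchor (base t) (vel t)))

/-- The base curve of some admissible curve connects `p` and `q`. -/
def Connects (p q : M) : Prop :=
  ∃ γ : A.AdmissibleCurve, γ.base 0 = p ∧ γ.base 1 = q

variable {A}

namespace Connection

variable (nab : A.Connection)

/-- The section `∇_v u`. -/
def sec (v u : Cₛ^∞⟮𝓡 m; F, E⟯) : Cₛ^∞⟮𝓡 m; F, E⟯ :=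
  ⟨fun x => nab.D u x (v x), nab.contMDiff_D u v⟩

/-- The Levi-Civita connection of `G`: vanishing torsion and metric compatibility. -/
structure IsLeviCivita (G : ContMDiffRiemannianMetric (𝓡 m) ∞ F E) : Prop where
  torsion_eq_zero : ∀ u v : Cₛ^∞⟮𝓡 m; F, E⟯, nab.sec u v - nab.sec v u - A.bracket u v = 0
  metric : ∀ (u v w : Cₛ^∞⟮𝓡 m; F, E⟯) (x : M),
    A.deriv (fun y => G.inner y (v y) (w y)) x (u x) =
      G.inner x (nab.sec u v x) (w x) + G.inner x (v x) (nab.sec u w x)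

/-- The curvature `R(u, v) w = ∇_u ∇_v w - ∇_v ∇_u w - ∇_{[u, v]} w`. -/
def curvature (u v w : Cₛ^∞⟮𝓡 m; F, E⟯) : Cₛ^∞⟮𝓡 m; F, E⟯ :=
  nab.sec u (nab.sec v w) - nab.sec v (nab.sec u w) - nab.sec (A.bracket u v) w

/-- The curvature tensor at `x`: `R(a, b) c ∈ E_x` for vectors `a, b, c ∈ E_x`, computed with any
smooth sections through these vectors (the value does not depend on their choice). -/
def curvatureAt (x : M) (a b c : E x) : E x :=
  nab.curvature (exists_smoothSection_eq (m := m) (F := F) a).choose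
    (exists_smoothSection_eq (m := m) (F := F) b).choose
    (exists_smoothSection_eq (m := m) (F := F) c).choose x

/-- The tensor `L_{ab} = (∇_a u)^c G_{cb}` of a section `u` at `x`: `L(a, b) = ⟨∇_a u|b⟩`. -/
def lowered (G : ContMDiffRiemannianMetric (𝓡 m) ∞ F E) (u : Cₛ^∞⟮𝓡 m; F, E⟯) (x : M) :
    E x →ₗ[ℝ] E x →ₗ[ℝ] ℝ :=
  LinearMap.mk₂ ℝ (fun a b => G.inner x (nab.D u x a) b)
    (by intros; simp) (by intros; simp) (by intros; simp) (by intros; simp)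

/-- `W ∈ E_{x(t)}` is the covariant derivative at time `t` of the curve `U(τ) ∈ E_{x(τ)}` along the
admissible curve `γ`: near `t` one has `U(τ) = ∑ fᵢ(τ) sᵢ(x(τ))` with sections `sᵢ` and functions
`fᵢ` differentiable at `t`, and `W = ∑ (fᵢ'(t) sᵢ(x(t)) + fᵢ(t) (∇_{v(t)} sᵢ)(x(t)))`. -/
def HasCovDerivAlong (γ : A.AdmissibleCurve) (U : ∀ t, E (γ.base t)) (t : ℝ)
    (W : E (γ.base t)) : Prop :=
  ∃ (k : ℕ) (f : Fin k → ℝ → ℝ) (f' : Fin k → ℝ) (s : Fin k → Cₛ^∞⟮𝓡 m; F, E⟯),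
    (∀ᶠ τ in 𝓝[Icc 0 1] t, U τ = ∑ i, f i τ • s i (γ.base τ)) ∧
    (∀ i, HasDerivWithinAt (f i) (f' i) (Icc 0 1) t) ∧
    W = ∑ i, (f' i • s i (γ.base t) + f i t • nab.D (s i) (γ.base t) (γ.vel t))

/-- `W` is the covariant derivative at time `t` of the curve `Λ(τ)` of bilinear forms on `E_{x(τ)}`
along the admissible curve `γ`: for all sections `y, z`,
`d/dt Λ(y, z) = W(y, z) + Λ(∇_{v(t)} y, z) + Λ(y, ∇_{v(t)} z)`. -/
def HasCovDerivAlong₂ (γ : A.AdmissibleCurve)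
    (Λ : ∀ t, E (γ.base t) →ₗ[ℝ] E (γ.base t) →ₗ[ℝ] ℝ) (t : ℝ)
    (W : E (γ.base t) → E (γ.base t) → ℝ) : Prop :=
  ∀ y z : Cₛ^∞⟮𝓡 m; F, E⟯,
    HasDerivWithinAt (fun τ => Λ τ (y (γ.base τ)) (z (γ.base τ)))
      (W (y (γ.base t)) (z (γ.base t))
        + Λ t (nab.D y (γ.base t) (γ.vel t)) (z (γ.base t))
        + Λ t (y (γ.base t)) (nab.D z (γ.base t) (γ.vel t))) (Icc 0 1) t

/-- `(U, Λ)` solves on `[0, 1]`, along the admissible curve `γ` with velocity `v`, the system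
`⟨∇_v U|a⟩ = Λ(v, a)` and `(∇_v Λ)(c, a) = -⟨R(c, a) U|v⟩`, for all `a, c ∈ E_{x(t)}`. -/
def SolvesKillingSystem (G : ContMDiffRiemannianMetric (𝓡 m) ∞ F E) (γ : A.AdmissibleCurve)
    (U : ∀ t, E (γ.base t)) (Λ : ∀ t, E (γ.base t) →ₗ[ℝ] E (γ.base t) →ₗ[ℝ] ℝ) : Prop :=
  ∀ t ∈ Icc (0 : ℝ) 1,
    (∃ W : E (γ.base t), nab.HasCovDerivAlong γ U t W ∧
      ∀ a, G.inner (γ.base t) W a = Λ t (γ.vel t) a) ∧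
    nab.HasCovDerivAlong₂ γ Λ t
      (fun c a => - G.inner (γ.base t) (nab.curvatureAt (γ.base t) c a (U t)) (γ.vel t))

end Connection

end LieAlgebroid

end LieAlgebroids

end

/-! # Killing sections of Riemannian Lie algebroids

A Killing section solves a linear system along admissible curves, and solutions of this system are
determined by their initial value. The proof uses global sections that form a frame near a given
point, tensoriality and the symmetries of the curvature, and Gronwall's inequality. -/

set_option linter.unusedSectionVars false

noncomputable section

section KillingSections

variable {m : ℕ} {M : Type*} [TopologicalSpace M] [T2Space M]
  [ChartedSpace (EuclideanSpace ℝ (Fin m)) M] [IsManifold (𝓡 m) ∞ M]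
  {F : Type*} [NormedAddCommGroup F] [NormedSpace ℝ F]
  {E : M → Type*} [∀ x, AddCommGroup (E x)] [∀ x, Module ℝ (E x)]
  [∀ x, TopologicalSpace (E x)] [TopologicalSpace (TotalSpace F E)]
  [FiberBundle F E] [VectorBundle ℝ F E] [ContMDiffVectorBundle ∞ F E (𝓡 m)]

/-! A Killing section `u` is governed by the pair (u, ∇u) because its second covariant derivative is
algebraic in `u`. Put K(v, y, z) = ⟨∇_v ∇_y u - ∇_{∇_v y} u|z⟩. Differentiating the antisymmetry of
L (`IsKilling.lowered_antisymm`) makes K antisymmetric in y, z, and vanishing torsion gives the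
Ricci identity K(v, y, z) - K(y, v, z) = ⟨R(v, y)u|z⟩. As in the Koszul formula, these two facts
determine K, and the first Bianchi identity turns the result into -⟨R(y, z)u|v⟩
(`IsKilling.inner_sec_sec`). So (u, L) satisfies a closed linear system along admissible curves.

That the anchor respects brackets is not an axiom. It follows from the Jacobi identity, but only
where the fibre is nonzero (`deriv_bracket_smul`); this is enough for the tensoriality and the
symmetries of the curvature.

For uniqueness, linearity reduces to zero initial data. Near every time the functions ⟨U|sᵢ⟩ and
Λ(sᵢ, sⱼ), with sections sᵢ spanning the nearby fibres, have derivatives bounded by a multiple of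
these functions (`exists_components`). Gronwall's inequality carries vanishing to the right, and the
set of times where the pair vanishes is closed, so no frame along the whole curve is needed. -/

/-! ### Global sections spanning nearby fibres, and tensoriality -/

theorem exists_smoothBump {x : M} {s : Set M} (hs : s ∈ 𝓝 x) :
    ∃ χ : C^∞⟮𝓡 m, M; ℝ⟯, tsupport χ ⊆ s ∧ ∀ᶠ y in 𝓝 x, χ y = 1 := by
  obtain ⟨f, -, hf⟩ := (SmoothBumpFunction.nhds_basis_tsupport (I := 𝓡 m) x).mem_iff.1 hs
  exact ⟨⟨f, f.contMDiff⟩, hf, f.eventuallyEq_one⟩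

@[simp]
theorem smulSection_apply (f : C^∞⟮𝓡 m, M; ℝ⟯) (u : Cₛ^∞⟮𝓡 m; F, E⟯) (x : M) :
    smulSection f u x = f x • u x := rfl

/-- Around every point there are finitely many global sections `sᵢ` and smooth coefficient
functions `cᵢ` on the total space with `∑ cᵢ(a) sᵢ = ψ a`, where `ψ` is `1` near the point. -/
theorem exists_smoothFrame [FiniteDimensional ℝ F] (x₀ : M) :
    ∃ (n : ℕ) (s : Fin n → Cₛ^∞⟮𝓡 m; F, E⟯) (c : Fin n → ∀ x, E x →ₗ[ℝ] ℝ)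
      (ψ : C^∞⟮𝓡 m, M; ℝ⟯),
      (∀ x (a : E x), ∑ i, c i x a • s i x = ψ x • a) ∧ (∀ᶠ x in 𝓝 x₀, ψ x = 1) ∧
      (∀ i (a : E x₀), ContinuousAt (fun p : TotalSpace F E => c i p.1 p.2) ⟨x₀, a⟩) ∧
      (∀ i (w : Cₛ^∞⟮𝓡 m; F, E⟯), ∃ f : C^∞⟮𝓡 m, M; ℝ⟯, ∀ x, f x = c i x (w x)) := by
  set e := trivializationAt F E x₀ with he
  have hx₀ : x₀ ∈ e.baseSet := mem_baseSet_trivializationAt F E x₀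
  have hopen : IsOpen e.baseSet := e.open_baseSet
  set b := Module.finBasis ℝ F
  obtain ⟨χ, hχ, hχ1⟩ := exists_smoothBump (m := m) (hopen.mem_nhds hx₀)
  have hχ0 : ∀ x, x ∉ e.baseSet → χ x = 0 := fun x hx =>
    image_eq_zero_of_notMem_tsupport fun h => hx (hχ h)
  -- Sections and coordinates both carry the cutoff χ, so that each extends by zero; hence ψ = χ².
  refine ⟨_, fun i => ⟨(χ : M → ℝ) • e.localFrame b i, ContMDiffOn.smul_section_of_tsupport
    χ.contMDiff.contMDiffOn hopen hχ (e.contMDiffOn_localFrame_baseSet ∞ b i)⟩,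
    fun i x => χ x • (b.coord i ∘ₗ e.linearMapAt ℝ x), χ * χ, ?_, ?_, ?_, ?_⟩
  · intro x a
    by_cases hx : x ∈ e.baseSet
    · have h := (e.basisAt b hx).sum_repr a
      simp only [Trivialization.basisAt, Module.Basis.map_repr, LinearEquiv.trans_apply,
        LinearEquiv.symm_symm] at h
      simp only [ContMDiffSection.coeFn_mk, Pi.smul_apply', LinearMap.smul_apply,
        LinearMap.comp_apply, Module.Basis.coord_apply, ContMDiffMap.coe_mul, Pi.mul_apply]
      conv_rhs => rw [← h, Finset.smul_sum]
      refine Finset.sum_congr rfl fun i _ => ?_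
      rw [e.localFrame_apply_of_mem_baseSet b hx]
      simp only [Trivialization.basisAt, smul_eq_mul, smul_smul, e.coe_linearMapAt_of_mem hx]
      congr 1
      simp only [Trivialization.linearEquivAt_apply]
      ring
    · simp [hχ0 x hx]
  · filter_upwards [hχ1] with x hx
    simp [hx]
  · intro i a
    have h1 : ContinuousAt (fun p : TotalSpace F E => χ p.1) ⟨x₀, a⟩ :=
      (χ.contMDiff.continuous.comp (FiberBundle.continuous_proj F E)).continuousAt
    have h2 : ContinuousAt (fun p : TotalSpace F E => b.coord i (e p).2) ⟨x₀, a⟩ :=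
      (LinearMap.continuous_of_finiteDimensional (b.coord i)).continuousAt.comp
        (continuous_snd.continuousAt.comp (e.continuousAt (e.mem_source.2 hx₀)))
    refine (h1.mul h2).congr ?_
    filter_upwards [(FiberBundle.continuous_proj F E).continuousAt.preimage_mem_nhds
      (hopen.mem_nhds hx₀)] with p hp
    simp [e.coe_linearMapAt_of_mem (R := ℝ) hp]
  · intro i w
    have h2 : ContMDiffOn (𝓡 m) 𝓘(ℝ, ℝ) ∞ (fun x => b.coord i (e (w x)).2) e.baseSet :=
      (LinearMap.toContinuousLinearMap (b.coord i)).contMDiff.comp_contMDiffOn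
        ((e.contMDiffOn_section_baseSet_iff).1 w.contMDiff.contMDiffOn)
    -- Smoothness has to be checked only on the support, which the cutoff keeps inside the base set.
    refine ⟨⟨_, contMDiff_of_tsupport fun x hx => ?_⟩, fun x => rfl⟩
    have hx' : x ∈ e.baseSet := by
      refine hχ (closure_mono ?_ hx)
      intro y hy
      simp only [Function.mem_support] at hy ⊢
      intro h0
      simp [h0] at hy
    refine (χ.contMDiff.contMDiffAt.mul
      (h2.contMDiffAt (hopen.mem_nhds hx'))).congr_of_eventuallyEq ?_
    filter_upwards [hopen.mem_nhds hx'] with y hy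
    simp [e.coe_linearMapAt_of_mem (R := ℝ) hy]

/-- A section that vanishes at `x` is a finite sum of sections `fᵢ sᵢ` with `fᵢ(x) = 0`. -/
theorem exists_eq_sum_smulSection [FiniteDimensional ℝ F] {x : M} {w : Cₛ^∞⟮𝓡 m; F, E⟯}
    (hw : w x = 0) :
    ∃ (n : ℕ) (f : Fin n → C^∞⟮𝓡 m, M; ℝ⟯) (s : Fin n → Cₛ^∞⟮𝓡 m; F, E⟯),
      (∀ i, f i x = 0) ∧ w = ∑ i, smulSection (f i) (s i) := by
  obtain ⟨n, s, c, ψ, hs, hψ, -, hc⟩ := exists_smoothFrame (m := m) (F := F) (E := E) x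
  choose f hf using fun i => hc i w
  -- The decomposition is w = (1 - ψ) w + ∑ cᵢ(w) sᵢ, where 1 - ψ vanishes at `x` and cᵢ(w) vanishes
  -- there with `w`.
  refine ⟨n + 1, Fin.cons (1 - ψ) f, Fin.cons w s, ?_, ?_⟩
  · intro i
    refine Fin.cases ?_ (fun j => ?_) i
    · simp [hψ.self_of_nhds]
    · simp [hf, hw]
  · ext y
    have hsum : ∀ (k : ℕ) (g : Fin k → Cₛ^∞⟮𝓡 m; F, E⟯), (∑ i, g i) y = ∑ i, g i y :=
      fun k g => map_sum ((Pi.evalAddMonoidHom E y).comp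
        (ContMDiffSection.coeAddHom (𝓡 m) F ∞ E)) g _
    rw [hsum, Fin.sum_univ_succ]
    simp only [Fin.cons_zero, Fin.cons_succ, smulSection_apply, hf, hs]
    simp [sub_smul]

/-- An additive operator on sections with values in an abelian group that vanishes on all products
`f s` with `f(x) = 0` depends only on the value of the section at `x`. -/
theorem eq_of_apply_eq [FiniteDimensional ℝ F] {V : Type*} [AddCommGroup V] {x : M}
    (T : Cₛ^∞⟮𝓡 m; F, E⟯ →+ V)
    (hT : ∀ (f : C^∞⟮𝓡 m, M; ℝ⟯) (s), f x = 0 → T (smulSection f s) = 0)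
    {u v : Cₛ^∞⟮𝓡 m; F, E⟯} (h : u x = v x) : T u = T v := by
  obtain ⟨n, f, s, hf, hsum⟩ := exists_eq_sum_smulSection (m := m) (x := x) (w := u - v)
    (by simp [h])
  rw [← sub_eq_zero, ← map_sub, hsum, map_sum]
  exact Finset.sum_eq_zero fun i _ => hT _ _ (hf i)

/-- The function `⟨v|w⟩` on `M`. -/
def innerFun (G : ContMDiffRiemannianMetric (𝓡 m) ∞ F E) (v w : Cₛ^∞⟮𝓡 m; F, E⟯) :
    C^∞⟮𝓡 m, M; ℝ⟯ :=
  ⟨fun x => G.inner x (v x) (w x), by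
    have h : ContMDiff (𝓡 m) ((𝓡 m).prod 𝓘(ℝ)) ∞
        (fun x => TotalSpace.mk' ℝ (E := Bundle.Trivial M ℝ) x (G.inner x (v x) (w x))) :=
      ContMDiff.clm_bundle_apply₂ (F₁ := F) (F₂ := F) G.contMDiff v.contMDiff w.contMDiff
    intro x
    exact (contMDiffAt_totalSpace.1 (h x)).2⟩

@[simp]
theorem innerFun_apply (G : ContMDiffRiemannianMetric (𝓡 m) ∞ F E) (v w : Cₛ^∞⟮𝓡 m; F, E⟯)
    (x : M) : innerFun G v w x = G.inner x (v x) (w x) := rfl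

variable [FiniteDimensional ℝ F] [∀ x, IsTopologicalAddGroup (E x)]
  [∀ x, ContinuousConstSMul ℝ (E x)]

/-! ### Derivatives of functions along sections and curves -/

namespace LieAlgebroid

variable (A : LieAlgebroid m M F E)

/-- The function `ρ(u)[f]`. -/
def derivFun (u : Cₛ^∞⟮𝓡 m; F, E⟯) (f : C^∞⟮𝓡 m, M; ℝ⟯) : C^∞⟮𝓡 m, M; ℝ⟯ :=
  ⟨fun x => A.deriv f x (u x), by
    have h := (f.contMDiff.contMDiff_tangentMap (m := ∞) le_rfl).comp (A.contMDiff_anchor u)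
    exact (contMDiff_snd_tangentBundle_modelSpace ℝ 𝓘(ℝ, ℝ)).comp h⟩

@[simp]
theorem derivFun_apply (u : Cₛ^∞⟮𝓡 m; F, E⟯) (f : C^∞⟮𝓡 m, M; ℝ⟯) (x : M) :
    A.derivFun u f x = A.deriv f x (u x) := rfl

theorem AdmissibleCurve.hasDerivWithinAt_comp {A : LieAlgebroid m M F E} (γ : A.AdmissibleCurve)
    (f : C^∞⟮𝓡 m, M; ℝ⟯) {t : ℝ} (ht : t ∈ Icc (0 : ℝ) 1) :
    HasDerivWithinAt (fun τ => f (γ.base τ)) (A.deriv f (γ.base t) (γ.vel t)) (Icc 0 1) t := by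
  have hf : HasMFDerivAt (𝓡 m) 𝓘(ℝ, ℝ) f (γ.base t) _ :=
    (f.contMDiff.mdifferentiableAt (by simp)).hasMFDerivAt
  have h := (hf.comp_hasMFDerivWithinAt t (γ.hasMFDerivWithinAt t ht)).hasFDerivWithinAt
  rw [hasDerivWithinAt_iff_hasFDerivWithinAt]
  refine h.congr_fderiv ?_
  ext
  change mfderiv (𝓡 m) 𝓘(ℝ, ℝ) f (γ.base t) ((1 : ℝ) • A.anchor (γ.base t) (γ.vel t)) =
    (1 : ℝ) • mfderiv (𝓡 m) 𝓘(ℝ, ℝ) f (γ.base t) (A.anchor (γ.base t) (γ.vel t))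
  rw [one_smul]
  exact (one_smul ℝ _).symm

theorem AdmissibleCurve.continuousOn_base {A : LieAlgebroid m M F E} (γ : A.AdmissibleCurve) :
    ContinuousOn γ.base (Icc 0 1) :=
  (FiberBundle.continuous_proj F E).comp_continuousOn γ.continuousOn

end LieAlgebroid

/-! ### Bracket identities -/

namespace LieAlgebroid

variable (A : LieAlgebroid m M F E)

theorem derivFun_add (u : Cₛ^∞⟮𝓡 m; F, E⟯) (f g : C^∞⟮𝓡 m, M; ℝ⟯) :
    A.derivFun u (f + g) = A.derivFun u f + A.derivFun u g := by
  ext x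
  simp only [derivFun_apply, LieAlgebroid.deriv, ContMDiffMap.coe_add, Pi.add_apply]
  rw [mvfderiv_add (f.contMDiff.mdifferentiableAt (by simp))
    (g.contMDiff.mdifferentiableAt (by simp))]
  simp

theorem deriv_neg (f : M → ℝ) (x : M) (a : E x) :
    A.deriv (-f) x a = - A.deriv f x a := by
  simp [LieAlgebroid.deriv, mvfderiv_neg]

theorem bracket_smulSection (u : Cₛ^∞⟮𝓡 m; F, E⟯) (f : C^∞⟮𝓡 m, M; ℝ⟯) (v : Cₛ^∞⟮𝓡 m; F, E⟯) :
    A.bracket u (smulSection f v) =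
      smulSection (A.derivFun u f) v + smulSection f (A.bracket u v) := by
  ext x
  exact A.leibniz f u v x

theorem bracket_neg (u v : Cₛ^∞⟮𝓡 m; F, E⟯) : A.bracket u (-v) = - A.bracket u v := by
  have h := A.bracket_smul (-1) u v
  simpa using h

theorem bracket_add_left (u v w : Cₛ^∞⟮𝓡 m; F, E⟯) :
    A.bracket (u + v) w = A.bracket u w + A.bracket v w := by
  rw [A.bracket_skew, A.bracket_add, A.bracket_skew u, A.bracket_skew v, neg_add]

theorem bracket_smulSection_left (f : C^∞⟮𝓡 m, M; ℝ⟯) (u v : Cₛ^∞⟮𝓡 m; F, E⟯) :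
    A.bracket (smulSection f u) v =
      smulSection f (A.bracket u v) - smulSection (A.derivFun v f) u := by
  rw [A.bracket_skew, A.bracket_smulSection, A.bracket_skew u v]
  ext x
  simp only [ContMDiffSection.coe_neg, ContMDiffSection.coe_add, ContMDiffSection.coe_sub,
    Pi.neg_apply, Pi.add_apply, Pi.sub_apply, smulSection_apply, derivFun_apply]
  module

theorem jacobi_bracket_left (u v w : Cₛ^∞⟮𝓡 m; F, E⟯) :
    A.bracket (A.bracket u v) w = A.bracket u (A.bracket v w) - A.bracket v (A.bracket u w) := by
  have h := A.jacobi u v w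
  rw [A.bracket_skew w u, A.bracket_neg, A.bracket_skew w] at h
  rw [← sub_eq_zero, ← neg_eq_zero, ← h]
  abel

/-- The anchor maps brackets to commutators wherever the bundle is nonzero. -/
theorem deriv_bracket_smul (u v w : Cₛ^∞⟮𝓡 m; F, E⟯) (f : C^∞⟮𝓡 m, M; ℝ⟯) (x : M) :
    A.deriv f x (A.bracket u v x) • w x =
      (A.deriv (A.derivFun v f) x (u x) - A.deriv (A.derivFun u f) x (v x)) • w x := by
  -- In the Jacobi identity for u, v, f w the terms with one derivative of `f` times a bracket
  -- cancel; subtracting `f` times the identity for u, v, w leaves multiples of `w`.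
  have h := congrArg (fun s => s x) (A.jacobi_bracket_left u v (smulSection f w))
  have h' := congrArg (fun s => s x) (A.jacobi_bracket_left u v w)
  simp only [bracket_smulSection, bracket_add, ContMDiffSection.coe_add, Pi.add_apply,
    ContMDiffSection.coe_sub, Pi.sub_apply, smulSection_apply, derivFun_apply] at h h'
  rw [h'] at h
  linear_combination (norm := module) h

variable {A}

/-! ### Tensoriality of the curvature -/

namespace Connection

variable (nab : A.Connection)

@[simp]
theorem sec_apply (v u : Cₛ^∞⟮𝓡 m; F, E⟯) (x : M) : nab.sec v u x = nab.D u x (v x) := rfl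

/-- The operator `u ↦ (∇_a u)(x)`. -/
def covDerivHom (x : M) (a : E x) : Cₛ^∞⟮𝓡 m; F, E⟯ →+ E x :=
  AddMonoidHom.mk' (fun u => nab.D u x a) fun u v => nab.D_add u v x a

theorem D_sub (u v : Cₛ^∞⟮𝓡 m; F, E⟯) (x : M) (a : E x) :
    nab.D (u - v) x a = nab.D u x a - nab.D v x a :=
  map_sub (nab.covDerivHom x a) u v

theorem sec_add (v u w : Cₛ^∞⟮𝓡 m; F, E⟯) : nab.sec v (u + w) = nab.sec v u + nab.sec v w := by
  ext x
  exact nab.D_add u w x _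

theorem sec_add_left (v v' u : Cₛ^∞⟮𝓡 m; F, E⟯) :
    nab.sec (v + v') u = nab.sec v u + nab.sec v' u := by
  ext x
  exact map_add (nab.D u x) _ _

theorem sec_smulSection (v : Cₛ^∞⟮𝓡 m; F, E⟯) (f : C^∞⟮𝓡 m, M; ℝ⟯) (u : Cₛ^∞⟮𝓡 m; F, E⟯) :
    nab.sec v (smulSection f u) = smulSection f (nab.sec v u) + smulSection (A.derivFun v f) u := by
  ext x
  exact nab.D_leibniz f u x _

theorem sec_smulSection_left (f : C^∞⟮𝓡 m, M; ℝ⟯) (v u : Cₛ^∞⟮𝓡 m; F, E⟯) :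
    nab.sec (smulSection f v) u = smulSection f (nab.sec v u) := by
  ext x
  exact map_smul (nab.D u x) _ _

theorem curvature_swap (u v w : Cₛ^∞⟮𝓡 m; F, E⟯) :
    nab.curvature u v w = - nab.curvature v u w := by
  ext x
  simp only [curvature, A.bracket_skew u v, ContMDiffSection.coe_sub, ContMDiffSection.coe_neg,
    Pi.sub_apply, Pi.neg_apply, sec_apply, map_neg]
  abel

theorem curvature_add (u v w w' : Cₛ^∞⟮𝓡 m; F, E⟯) :
    nab.curvature u v (w + w') = nab.curvature u v w + nab.curvature u v w' := by
  simp only [curvature, sec_add]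
  abel

theorem curvature_add_left (u u' v w : Cₛ^∞⟮𝓡 m; F, E⟯) :
    nab.curvature (u + u') v w = nab.curvature u v w + nab.curvature u' v w := by
  simp only [curvature, sec_add, sec_add_left, A.bracket_add_left]
  abel

/-- The second derivatives of `f` cancel against ρ([u, v])[f]. They occur multiplied by `w`, so
`deriv_bracket_smul` suffices. -/
theorem curvature_smulSection (u v : Cₛ^∞⟮𝓡 m; F, E⟯) (f : C^∞⟮𝓡 m, M; ℝ⟯)
    (w : Cₛ^∞⟮𝓡 m; F, E⟯) :
    nab.curvature u v (smulSection f w) = smulSection f (nab.curvature u v w) := by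
  ext x
  have h := A.deriv_bracket_smul u v w f x
  simp only [curvature, sec_smulSection, sec_add, ContMDiffSection.coe_sub,
    ContMDiffSection.coe_add, Pi.sub_apply, Pi.add_apply, smulSection_apply, derivFun_apply]
  linear_combination (norm := module) -h

/-- No property of the anchor on brackets enters: the term ρ(v)[f] ∇_u w from the Leibniz rule
cancels against the one from [f u, v]. -/
theorem curvature_smulSection_left (f : C^∞⟮𝓡 m, M; ℝ⟯) (u v w : Cₛ^∞⟮𝓡 m; F, E⟯) :
    nab.curvature (smulSection f u) v w = smulSection f (nab.curvature u v w) := by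
  ext x
  simp only [curvature, sec_smulSection, sec_smulSection_left, A.bracket_smulSection_left,
    ContMDiffSection.coe_sub, ContMDiffSection.coe_add, Pi.sub_apply, Pi.add_apply,
    smulSection_apply, derivFun_apply, sec_apply, map_sub, map_smul]
  module

theorem curvature_congr_left {u u' : Cₛ^∞⟮𝓡 m; F, E⟯} {x : M} (h : u x = u' x)
    (v w : Cₛ^∞⟮𝓡 m; F, E⟯) : nab.curvature u v w x = nab.curvature u' v w x :=
  eq_of_apply_eq (AddMonoidHom.mk' (fun u => nab.curvature u v w x)
    fun u u' => by rw [curvature_add_left]; rfl)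
    (fun f s hf => by simp [curvature_smulSection_left, hf]) h

theorem curvature_congr_right (u v : Cₛ^∞⟮𝓡 m; F, E⟯) {w w' : Cₛ^∞⟮𝓡 m; F, E⟯} {x : M}
    (h : w x = w' x) : nab.curvature u v w x = nab.curvature u v w' x :=
  eq_of_apply_eq (AddMonoidHom.mk' (fun w => nab.curvature u v w x)
    fun w w' => by rw [curvature_add]; rfl)
    (fun f s hf => by simp [curvature_smulSection, hf]) h

theorem curvatureAt_apply (u v w : Cₛ^∞⟮𝓡 m; F, E⟯) (x : M) :
    nab.curvatureAt x (u x) (v x) (w x) = nab.curvature u v w x := by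
  unfold curvatureAt
  -- The chosen sections are replaced one slot at a time; the middle slot is moved to the front by
  -- antisymmetry.
  rw [nab.curvature_congr_right _ _ (exists_smoothSection_eq (m := m) (F := F) (w x)).choose_spec,
    nab.curvature_congr_left (exists_smoothSection_eq (m := m) (F := F) (u x)).choose_spec,
    curvature_swap, ContMDiffSection.coe_neg, Pi.neg_apply,
    nab.curvature_congr_left (exists_smoothSection_eq (m := m) (F := F) (v x)).choose_spec,
    ← Pi.neg_apply, ← ContMDiffSection.coe_neg, ← curvature_swap]

theorem curvatureAt_smul_add_smul (x : M) (a b w w' : E x) (c c' : ℝ) :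
    nab.curvatureAt x a b (c • w + c' • w') =
      c • nab.curvatureAt x a b w + c' • nab.curvatureAt x a b w' := by
  obtain ⟨a, rfl⟩ := exists_smoothSection_eq (m := m) (F := F) a
  obtain ⟨b, rfl⟩ := exists_smoothSection_eq (m := m) (F := F) b
  obtain ⟨w, rfl⟩ := exists_smoothSection_eq (m := m) (F := F) w
  obtain ⟨w', rfl⟩ := exists_smoothSection_eq (m := m) (F := F) w'
  have h := nab.curvatureAt_apply a b
    (smulSection (ContMDiffMap.const c) w + smulSection (ContMDiffMap.const c') w') x
  rw [curvature_add, curvature_smulSection, curvature_smulSection] at h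
  simp only [curvatureAt_apply]
  exact h

variable {nab} {G : ContMDiffRiemannianMetric (𝓡 m) ∞ F E}

@[simp]
theorem lowered_apply (u : Cₛ^∞⟮𝓡 m; F, E⟯) (x : M) (a b : E x) :
    nab.lowered G u x a b = G.inner x (nab.D u x a) b := rfl

/-! ### Symmetries of the Levi-Civita curvature -/

namespace IsLeviCivita

variable (h : nab.IsLeviCivita G)
include h

theorem bracket_eq (u v : Cₛ^∞⟮𝓡 m; F, E⟯) : A.bracket u v = nab.sec u v - nab.sec v u :=
  (sub_eq_zero.1 (h.torsion_eq_zero u v)).symm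

theorem derivFun_innerFun (u v w : Cₛ^∞⟮𝓡 m; F, E⟯) :
    A.derivFun u (innerFun G v w) = innerFun G (nab.sec u v) w + innerFun G v (nab.sec u w) := by
  ext x
  exact h.metric u v w x

/-- The curvature is antisymmetric with respect to the metric. -/
theorem inner_curvature_add (u v w z : Cₛ^∞⟮𝓡 m; F, E⟯) (x : M) :
    G.inner x (nab.curvature u v w x) (z x) + G.inner x (w x) (nab.curvature u v z x) = 0 := by
  -- The commutator identity for ρ is available only multiplied by a vector, here `w x`, so the case
  -- `w x = 0` is separate. Otherwise it is applied to ⟨w|z⟩ and expanded by metric compatibility;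
  -- the mixed terms ⟨∇w|∇z⟩ cancel.
  by_cases hw : w x = 0
  · rw [nab.curvature_congr_right u v (w' := smulSection 0 w) (by simpa using hw),
      curvature_smulSection, hw]
    simp
  have h1 := smul_left_injective ℝ hw (A.deriv_bracket_smul u v w (innerFun G w z) x)
  simp only [← derivFun_apply, h.derivFun_innerFun, derivFun_add] at h1
  simp only [ContMDiffMap.coe_add, Pi.add_apply, innerFun_apply] at h1
  simp only [curvature, ContMDiffSection.coe_sub, Pi.sub_apply, map_sub,
    _root_.sub_apply]
  linarith

/-- The first Bianchi identity. -/
theorem bianchi (u v w : Cₛ^∞⟮𝓡 m; F, E⟯) (x : M) :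
    nab.curvature u v w x + nab.curvature v w u x + nab.curvature w u v x = 0 := by
  have h1 := congrArg (fun s => s x) (A.jacobi u v w)
  -- Vanishing torsion, used for both brackets, turns the Jacobi identity into the cyclic sum of
  -- curvatures.
  have h2 : ∀ a b c, A.bracket a (A.bracket b c) x =
      nab.D (nab.sec b c) x (a x) - nab.D (nab.sec c b) x (a x) -
        nab.D a x (A.bracket b c x) := by
    intro a b c
    rw [h.bracket_eq a (A.bracket b c), ContMDiffSection.coe_sub, Pi.sub_apply, sec_apply,
      sec_apply, ← D_sub, ← h.bracket_eq b c]
  simp only [ContMDiffSection.coe_add, Pi.add_apply, ContMDiffSection.coe_zero,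
    Pi.zero_apply, h2] at h1
  rw [← h1]
  simp only [curvature, ContMDiffSection.coe_sub, Pi.sub_apply, sec_apply]
  abel

end IsLeviCivita

end Connection

/-! ### First and second covariant derivatives of Killing sections -/

/-- Writing ρ(u)⟨v|w⟩ and the brackets through ∇, all ∇_u terms cancel in the Killing equation and
⟨∇_v u|w⟩ + ⟨v|∇_w u⟩ = 0 remains. -/
theorem IsKilling.lowered_antisymm {nab : A.Connection}
    {G : ContMDiffRiemannianMetric (𝓡 m) ∞ F E} (h : nab.IsLeviCivita G)
    {u : Cₛ^∞⟮𝓡 m; F, E⟯} (hu : A.IsKilling G u) (x : M) (a b : E x) :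
    nab.lowered G u x a b = - nab.lowered G u x b a := by
  obtain ⟨v, rfl⟩ := exists_smoothSection_eq (m := m) (F := F) a
  obtain ⟨w, rfl⟩ := exists_smoothSection_eq (m := m) (F := F) b
  have h1 := hu v w x
  simp only [lieDerivMetric, h.metric, h.bracket_eq, ContMDiffSection.coe_sub, Pi.sub_apply,
    map_sub, _root_.sub_apply, Connection.sec_apply] at h1
  simp only [Connection.lowered_apply]
  rw [G.symm x (nab.D u x (w x))]
  linarith

/-- The second covariant derivative of a Killing section `u` is given by the curvature:
`⟨∇_v ∇_y u - ∇_{∇_v y} u|z⟩ = -⟨R(y, z) u|v⟩`. -/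
theorem IsKilling.inner_sec_sec {nab : A.Connection}
    {G : ContMDiffRiemannianMetric (𝓡 m) ∞ F E} (h : nab.IsLeviCivita G)
    {u : Cₛ^∞⟮𝓡 m; F, E⟯} (hu : A.IsKilling G u) (v y z : Cₛ^∞⟮𝓡 m; F, E⟯) (x : M) :
    G.inner x (nab.sec v (nab.sec y u) x) (z x) - G.inner x (nab.sec (nab.sec v y) u x) (z x) =
      - G.inner x (nab.curvature y z u x) (v x) := by
  set K : Cₛ^∞⟮𝓡 m; F, E⟯ → Cₛ^∞⟮𝓡 m; F, E⟯ → Cₛ^∞⟮𝓡 m; F, E⟯ → ℝ := fun v y z =>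
    G.inner x (nab.sec v (nab.sec y u) x) (z x) - G.inner x (nab.sec (nab.sec v y) u x) (z x)
    with hK
  set R : Cₛ^∞⟮𝓡 m; F, E⟯ → Cₛ^∞⟮𝓡 m; F, E⟯ → Cₛ^∞⟮𝓡 m; F, E⟯ → ℝ := fun v y z =>
    G.inner x (nab.curvature v y u x) (z x) with hR
  have hanti : ∀ v y z, K v y z = - K v z y := by
    intro v y z
    have h1 : innerFun G (nab.sec y u) z = - innerFun G (nab.sec z u) y := by
      ext p
      exact hu.lowered_antisymm h p (y p) (z p)
    have h2 := congrArg (fun f : C^∞⟮𝓡 m, M; ℝ⟯ => A.deriv f x (v x)) h1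
    simp only [ContMDiffMap.coe_neg, deriv_neg] at h2
    simp only [← derivFun_apply, h.derivFun_innerFun] at h2
    simp only [ContMDiffMap.coe_add, Pi.add_apply, innerFun_apply, Connection.sec_apply] at h2
    have h3 := hu.lowered_antisymm h x (nab.D y x (v x)) (z x)
    have h4 := hu.lowered_antisymm h x (nab.D z x (v x)) (y x)
    simp only [Connection.lowered_apply] at h3 h4
    simp only [hK, Connection.sec_apply]
    linarith
  have hcomm : ∀ v y z, K v y z - K y v z = R v y z := by
    intro v y z
    simp only [hK, hR, Connection.curvature, h.bracket_eq v y, ContMDiffSection.coe_sub,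
      Pi.sub_apply, map_sub, _root_.sub_apply, Connection.sec_apply]
    ring
  have hswap : ∀ v y z, R v y z = - R y v z := by
    intro v y z
    simp only [hR]
    rw [nab.curvature_swap v y]
    simp
  -- Metric antisymmetry moves the curvature off `u`, and the Bianchi identity applies to the other
  -- factor.
  have hcyc : R v y z + R y z v + R z v y = 0 := by
    have h1 := h.inner_curvature_add v y u z x
    have h2 := h.inner_curvature_add y z u v x
    have h3 := h.inner_curvature_add z v u y x
    have h4 := congrArg (G.inner x (u x)) (h.bianchi v y z x)
    simp only [map_add, map_zero] at h4
    simp only [hR]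
    linarith
  show K v y z = - R y z v
  -- Alternating the swaps of the last two and the first two slots returns to -K(v, y, z), so 2 K(v,
  -- y, z) = R(z, v, y) + R(v, y, z) - R(y, z, v), which is -2 R(y, z, v) by the cyclic identity.
  linarith [hanti v y z, hanti z v y, hanti y z v, hcomm v z y, hcomm z y v, hcomm y v z,
    hswap v y z, hswap y z v, hswap z v y]

end LieAlgebroid

/-! ### Gronwall's inequality and bounds in a frame -/

/-- Continuous induction for a property that is, near every point of `[0, 1]`, the vanishing of a
function `y` with `|y'| ≤ C |y|`. -/
theorem forall_mem_Icc_of_isBigO_deriv {P : ℝ → Prop} (h0 : P 0)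
    (hP : ∀ t₀ ∈ Icc (0 : ℝ) 1, ∃ (ι : Type) (_ : Fintype ι) (y y' : ι → ℝ → ℝ),
      (∀ i, ∀ t ∈ Icc (0 : ℝ) 1, HasDerivWithinAt (y i) (y' i t) (Icc 0 1) t) ∧
      (∀ i, y' i =O[𝓝[Icc 0 1] t₀] fun t i => y i t) ∧
      (∀ᶠ t in 𝓝[Icc 0 1] t₀, P t ↔ ∀ i, y i t = 0)) :
    ∀ t ∈ Icc (0 : ℝ) 1, P t := by
  have hclosed : IsClosed ({t | P t} ∩ Icc 0 1) := by
    refine isClosed_of_closure_subset fun t ht => ?_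
    have htI : t ∈ Icc (0 : ℝ) 1 :=
      isClosed_Icc.closure_subset_iff.2 inter_subset_right ht
    refine ⟨?_, htI⟩
    obtain ⟨ι, _, y, y', hd, -, hiff⟩ := hP t htI
    refine (hiff.self_of_nhdsWithin htI).2 fun i => ?_
    by_contra hne
    have h1 : ∀ᶠ τ in 𝓝[Icc 0 1] t, y i τ ≠ 0 :=
      (hd i t htI).continuousWithinAt.eventually_ne hne
    have h2 : ∀ᶠ τ in 𝓝 t, τ ∈ Icc (0 : ℝ) 1 → ¬ P τ := by
      rw [← eventually_nhdsWithin_iff]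
      filter_upwards [h1, hiff] with τ h3 h4 h5
      exact h3 (h4.1 h5 i)
    obtain ⟨τ, h3, h4⟩ := ((mem_closure_iff_frequently.1 ht).and_eventually h2).exists
    exact h4 h3.2 h3.1
  refine fun t ht => hclosed.Icc_subset_of_forall_mem_nhdsWithin h0 ?_ ht
  rintro t₀ ⟨hPt, ht₀⟩
  obtain ⟨ι, _, y, y', hd, hO, hiff⟩ := hP t₀ (Ico_subset_Icc_self ht₀)
  obtain ⟨C, hC⟩ := (Asymptotics.isBigO_pi.2 hO).bound
  obtain ⟨ε, hε, hball⟩ := Metric.mem_nhdsWithin_iff.1 (hC.and hiff)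
  -- The interval from `t₀` to `b` stays in [0, 1] and in the ball where the bound on the derivative
  -- and the description of `P` hold.
  set b := min (t₀ + ε / 2) 1
  have hb : t₀ < b := lt_min (by linarith) ht₀.2
  have hsub : ∀ τ ∈ Icc t₀ b, τ ∈ Icc (0 : ℝ) 1 := fun τ hτ =>
    ⟨ht₀.1.trans hτ.1, hτ.2.trans (min_le_right _ _)⟩
  have hgood : ∀ τ ∈ Icc t₀ b, _ := fun τ hτ => hball ⟨by
    have := hτ.2.trans (min_le_left _ _)
    rw [Metric.mem_ball, Real.dist_eq, abs_of_nonneg (by linarith [hτ.1])]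
    linarith, hsub τ hτ⟩
  have hder : ∀ τ ∈ Icc (0 : ℝ) 1,
      HasDerivWithinAt (fun t i => y i t) (fun i => y' i τ) (Icc 0 1) τ :=
    fun τ hτ => hasDerivWithinAt_pi.2 fun i => hd i τ hτ
  have hzero := eq_zero_of_abs_deriv_le_mul_abs_self_of_eq_zero_right
    (f := fun t i => y i t) (f' := fun t i => y' i t) (K := C) (a := t₀) (b := b)
    (fun τ hτ => ((hder τ (hsub τ hτ)).continuousWithinAt).mono hsub)
    (fun τ hτ => (hder τ (hsub τ (Ico_subset_Icc_self hτ))).mono_of_mem_nhdsWithin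
      (Icc_mem_nhdsGE_of_mem ⟨ht₀.1.trans hτ.1, hτ.2.trans_le (min_le_right _ _)⟩))
    (funext ((hgood t₀ (left_mem_Icc.2 hb.le)).2.1 hPt))
    (fun τ hτ => (hgood τ (Ico_subset_Icc_self hτ)).1)
  filter_upwards [Icc_mem_nhdsGT hb] with τ hτ
  exact (hgood τ hτ).2.2 fun i => congrFun (hzero τ hτ) i

/-- Along a curve, linear forms that are bounded by `g` on the frame `s` are bounded by `g` on
curves of vectors with bounded coefficients. -/
theorem isBigO_apply_of_frame {l : Filter ℝ} {x : ℝ → M} {n : ℕ}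
    {s : Fin n → Cₛ^∞⟮𝓡 m; F, E⟯} {c : Fin n → ∀ x, E x →ₗ[ℝ] ℝ}
    (hs : ∀ᶠ t in l, ∀ a : E (x t), ∑ i, c i (x t) a • s i (x t) = a)
    {V : Type*} [NormedAddCommGroup V] [NormedSpace ℝ V] {g : ℝ → V}
    (f : ∀ t, E (x t) →ₗ[ℝ] ℝ) (hf : ∀ i, (fun t => f t (s i (x t))) =O[l] g)
    {a : ∀ t, E (x t)} (ha : ∀ i, (fun t => c i (x t) (a t)) =O[l] fun _ => (1 : ℝ)) :
    (fun t => f t (a t)) =O[l] g := by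
  have h : (fun t => ∑ i, c i (x t) (a t) • f t (s i (x t))) =O[l] g :=
    Asymptotics.IsBigO.fun_sum fun i _ => by simpa using (ha i).smul (hf i)
  refine h.congr' ?_ EventuallyEq.rfl
  filter_upwards [hs] with t ht
  conv_rhs => rw [← ht (a t)]
  simp

/-! ### Linearity and uniqueness for the system -/

namespace LieAlgebroid

variable {A : LieAlgebroid m M F E}

namespace Connection

variable {nab : A.Connection} {G : ContMDiffRiemannianMetric (𝓡 m) ∞ F E}

theorem IsLeviCivita.inner_curvatureAt (h : nab.IsLeviCivita G) (u v w : Cₛ^∞⟮𝓡 m; F, E⟯)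
    (x : M) (a : E x) :
    G.inner x (nab.curvatureAt x (u x) (v x) a) (w x) =
      - G.inner x a (nab.curvature u v w x) := by
  obtain ⟨a, rfl⟩ := exists_smoothSection_eq (m := m) (F := F) a
  rw [curvatureAt_apply]
  linarith [h.inner_curvature_add u v a w x]

theorem HasCovDerivAlong.smul_add_smul {γ : A.AdmissibleCurve} {U U' : ∀ t, E (γ.base t)} {t : ℝ}
    {W W' : E (γ.base t)} (h : nab.HasCovDerivAlong γ U t W) (h' : nab.HasCovDerivAlong γ U' t W')
    (c c' : ℝ) :
    nab.HasCovDerivAlong γ (fun t => c • U t + c' • U' t) t (c • W + c' • W') := by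
  obtain ⟨k, f, f', s, hU, hf, rfl⟩ := h
  obtain ⟨k₂, f₂, f₂', s₂, hU₂, hf₂, rfl⟩ := h'
  refine ⟨k + k₂, Fin.append (fun i τ => c * f i τ) (fun i τ => c' * f₂ i τ),
    Fin.append (fun i => c * f' i) (fun i => c' * f₂' i), Fin.append s s₂, ?_, ?_, ?_⟩
  · filter_upwards [hU, hU₂] with τ h1 h2
    simp [Fin.sum_univ_add, h1, h2, Finset.smul_sum, mul_smul]
  · intro i
    refine Fin.addCases (fun i => ?_) (fun i => ?_) i
    · simpa using (hf i).const_mul c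
    · simpa using (hf₂ i).const_mul c'
  · simp [Fin.sum_univ_add, Finset.smul_sum, mul_smul]

/-- This product rule holds for every representation of `U` through sections, so uniqueness of `W`
need not be discussed separately. -/
theorem HasCovDerivAlong.hasDerivWithinAt_inner (h : nab.IsLeviCivita G) {γ : A.AdmissibleCurve}
    {U : ∀ t, E (γ.base t)} {t : ℝ} (ht : t ∈ Icc (0 : ℝ) 1) {W : E (γ.base t)}
    (hU : nab.HasCovDerivAlong γ U t W) (z : Cₛ^∞⟮𝓡 m; F, E⟯) :
    HasDerivWithinAt (fun τ => G.inner (γ.base τ) (U τ) (z (γ.base τ)))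
      (G.inner (γ.base t) W (z (γ.base t)) +
        G.inner (γ.base t) (U t) (nab.D z (γ.base t) (γ.vel t))) (Icc 0 1) t := by
  obtain ⟨k, f, f', s, hU, hf, rfl⟩ := hU
  have hUt := hU.self_of_nhdsWithin ht
  have hd : ∀ i, HasDerivWithinAt (fun τ => innerFun G (s i) z (γ.base τ))
      (G.inner (γ.base t) (nab.D (s i) (γ.base t) (γ.vel t)) (z (γ.base t)) +
        G.inner (γ.base t) (s i (γ.base t)) (nab.D z (γ.base t) (γ.vel t))) (Icc 0 1) t := by
    intro i
    obtain ⟨v, hv⟩ := exists_smoothSection_eq (m := m) (F := F) (γ.vel t)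
    have h1 := h.metric v (s i) z (γ.base t)
    simp only [sec_apply, hv] at h1
    rw [← h1]
    exact γ.hasDerivWithinAt_comp (innerFun G (s i) z) ht
  have hsum := HasDerivWithinAt.fun_sum (u := Finset.univ) fun i _ => (hf i).mul (hd i)
  refine (hsum.congr_of_eventuallyEq ?_ ?_).congr_deriv ?_
  · filter_upwards [hU] with τ hτ
    simp [hτ]
  · simp [hUt]
  · simp only [hUt, map_sum, map_add, map_smul, _root_.add_apply, _root_.smul_apply,
      _root_.sum_apply, smul_eq_mul, innerFun_apply, ← Finset.sum_add_distrib]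
    exact Finset.sum_congr rfl fun i _ => by ring

theorem SolvesKillingSystem.smul_add_smul {γ : A.AdmissibleCurve} {U U' : ∀ t, E (γ.base t)}
    {Λ Λ' : ∀ t, E (γ.base t) →ₗ[ℝ] E (γ.base t) →ₗ[ℝ] ℝ}
    (h : nab.SolvesKillingSystem G γ U Λ) (h' : nab.SolvesKillingSystem G γ U' Λ') (c c' : ℝ) :
    nab.SolvesKillingSystem G γ (fun t => c • U t + c' • U' t)
      (fun t => c • Λ t + c' • Λ' t) := by
  intro t ht
  obtain ⟨⟨W, hW, hWΛ⟩, hΛ⟩ := h t ht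
  obtain ⟨⟨W', hW', hWΛ'⟩, hΛ'⟩ := h' t ht
  refine ⟨⟨c • W + c' • W', hW.smul_add_smul hW' c c', fun a => ?_⟩, fun y z => ?_⟩
  · simp [hWΛ, hWΛ']
  · have h1 := ((hΛ y z).const_mul c).add ((hΛ' y z).const_mul c')
    refine (h1.congr_deriv ?_).congr_of_eventuallyEq ?_ ?_
    · simp only [curvatureAt_smul_add_smul, map_add, map_smul, _root_.add_apply,
        _root_.smul_apply, LinearMap.add_apply, LinearMap.smul_apply, smul_eq_mul]
      ring
    · exact Eventually.of_forall fun τ => by simp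
    · simp

/-- Near every time the vanishing of a solution of the system is the vanishing of its components
in a frame, which satisfy a linear differential equation with bounded coefficients. -/
theorem SolvesKillingSystem.exists_components (h : nab.IsLeviCivita G) {γ : A.AdmissibleCurve}
    {U : ∀ t, E (γ.base t)} {Λ : ∀ t, E (γ.base t) →ₗ[ℝ] E (γ.base t) →ₗ[ℝ] ℝ}
    (hsol : nab.SolvesKillingSystem G γ U Λ) {t₀ : ℝ} (ht₀ : t₀ ∈ Icc (0 : ℝ) 1) :
    ∃ (ι : Type) (_ : Fintype ι) (y y' : ι → ℝ → ℝ),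
      (∀ i, ∀ t ∈ Icc (0 : ℝ) 1, HasDerivWithinAt (y i) (y' i t) (Icc 0 1) t) ∧
      (∀ i, y' i =O[𝓝[Icc 0 1] t₀] fun t i => y i t) ∧
      (∀ᶠ t in 𝓝[Icc 0 1] t₀, (U t = 0 ∧ Λ t = 0) ↔ ∀ i, y i t = 0) := by
  obtain ⟨n, s, c, ψ, hs, hψ, hcv, hcs⟩ :=
    exists_smoothFrame (m := m) (F := F) (E := E) (γ.base t₀)
  have hbase := γ.continuousOn_base t₀ ht₀
  have hframe : ∀ᶠ t in 𝓝[Icc 0 1] t₀, ∀ a, ∑ i, c i (γ.base t) a • s i (γ.base t) = a := by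
    filter_upwards [hbase.eventually hψ] with t ht a
    rw [hs, ht, one_smul]
  have hvel : ∀ i, (fun t => c i (γ.base t) (γ.vel t)) =O[𝓝[Icc 0 1] t₀] fun _ => (1 : ℝ) :=
    fun i => ((hcv i (γ.vel t₀)).tendsto.comp (γ.continuousOn t₀ ht₀)).isBigO_one ℝ
  have hsec : ∀ (w : Cₛ^∞⟮𝓡 m; F, E⟯) i,
      (fun t => c i (γ.base t) (w (γ.base t))) =O[𝓝[Icc 0 1] t₀] fun _ => (1 : ℝ) := by
    intro w i
    obtain ⟨f, hf⟩ := hcs i w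
    simp only [← hf]
    exact (f.contMDiff.continuous.continuousAt.tendsto.comp hbase).isBigO_one ℝ
  -- The velocity is merely continuous, so ∇_v w is expanded through the smooth sections ∇_{sⱼ} w
  -- with the bounded coefficients of v.
  have hD : ∀ (w : Cₛ^∞⟮𝓡 m; F, E⟯) i, (fun t => c i (γ.base t) (nab.D w (γ.base t) (γ.vel t)))
      =O[𝓝[Icc 0 1] t₀] fun _ => (1 : ℝ) := fun w i =>
    isBigO_apply_of_frame hframe (fun t => c i (γ.base t) ∘ₗ nab.D w (γ.base t))
      (fun j => hsec (nab.sec (s j) w) i) hvel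
  let y : Fin n ⊕ Fin n × Fin n → ℝ → ℝ := Sum.elim
    (fun i t => G.inner (γ.base t) (U t) (s i (γ.base t)))
    (fun p t => Λ t (s p.1 (γ.base t)) (s p.2 (γ.base t)))
  let y' : Fin n ⊕ Fin n × Fin n → ℝ → ℝ := Sum.elim
    (fun i t => Λ t (γ.vel t) (s i (γ.base t)) +
      G.inner (γ.base t) (U t) (nab.D (s i) (γ.base t) (γ.vel t)))
    (fun p t => - G.inner (γ.base t) (nab.curvatureAt (γ.base t) (s p.1 (γ.base t))
        (s p.2 (γ.base t)) (U t)) (γ.vel t) +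
      Λ t (nab.D (s p.1) (γ.base t) (γ.vel t)) (s p.2 (γ.base t)) +
      Λ t (s p.1 (γ.base t)) (nab.D (s p.2) (γ.base t) (γ.vel t)))
  have hy : ∀ i, y i =O[𝓝[Icc 0 1] t₀] fun t i => y i t := fun i =>
    Asymptotics.isBigO_pi.1 (Asymptotics.isBigO_refl (fun t i => y i t) _) i
  have hyU : ∀ {a : ∀ t, E (γ.base t)},
      (∀ i, (fun t => c i (γ.base t) (a t)) =O[𝓝[Icc 0 1] t₀] fun _ => (1 : ℝ)) →
      (fun t => G.inner (γ.base t) (U t) (a t)) =O[𝓝[Icc 0 1] t₀] fun t i => y i t := fun ha =>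
    isBigO_apply_of_frame hframe (fun t => (G.inner (γ.base t) (U t)).toLinearMap)
      (fun i => hy (.inl i)) ha
  have hyΛ₁ : ∀ {a : ∀ t, E (γ.base t)} (j),
      (∀ i, (fun t => c i (γ.base t) (a t)) =O[𝓝[Icc 0 1] t₀] fun _ => (1 : ℝ)) →
      (fun t => Λ t (a t) (s j (γ.base t))) =O[𝓝[Icc 0 1] t₀] fun t i => y i t := fun j ha =>
    isBigO_apply_of_frame hframe (fun t => (Λ t).flip (s j (γ.base t)))
      (fun i => hy (.inr (i, j))) ha
  have hyΛ₂ : ∀ {a : ∀ t, E (γ.base t)} (j),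
      (∀ i, (fun t => c i (γ.base t) (a t)) =O[𝓝[Icc 0 1] t₀] fun _ => (1 : ℝ)) →
      (fun t => Λ t (s j (γ.base t)) (a t)) =O[𝓝[Icc 0 1] t₀] fun t i => y i t := fun j ha =>
    isBigO_apply_of_frame hframe (fun t => Λ t (s j (γ.base t)))
      (fun i => hy (.inr (j, i))) ha
  refine ⟨Fin n ⊕ Fin n × Fin n, inferInstance, y, y', ?_, ?_, ?_⟩
  · rintro (i | ⟨i, j⟩) t ht
    · obtain ⟨⟨W, hW, hWΛ⟩, -⟩ := hsol t ht
      have h1 := hW.hasDerivWithinAt_inner h ht (s i)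
      rwa [hWΛ] at h1
    · exact (hsol t ht).2 (s i) (s j)
  · rintro (i | ⟨i, j⟩)
    · exact (hyΛ₁ i hvel).add (hyU (hD (s i)))
    · refine ((Asymptotics.IsBigO.neg_left ?_).add (hyΛ₁ j (hD (s i)))).add (hyΛ₂ i (hD (s j)))
      -- With the velocity expanded in the frame, metric antisymmetry moves the curvature off `U`:
      -- it remains to bound ⟨U|R(sᵢ, sⱼ)s_b⟩, where R(sᵢ, sⱼ)s_b is a smooth section.
      refine isBigO_apply_of_frame hframe (fun t => (G.inner (γ.base t)
        (nab.curvatureAt (γ.base t) (s i (γ.base t)) (s j (γ.base t)) (U t))).toLinearMap)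
        (fun b => ?_) hvel
      simp only [ContinuousLinearMap.coe_coe, h.inner_curvatureAt]
      exact (hyU (hsec (nab.curvature (s i) (s j) (s b)))).neg_left
  · filter_upwards [hframe] with t ht
    have hext : ∀ f : E (γ.base t) →ₗ[ℝ] ℝ, (∀ i, f (s i (γ.base t)) = 0) → ∀ a, f a = 0 := by
      intro f hf a
      rw [← ht a]
      simp [hf]
    refine ⟨fun ⟨hU, hΛ⟩ i => ?_, fun hy0 => ⟨?_, ?_⟩⟩
    · rcases i with i | ⟨i, j⟩ <;> simp [y, hU, hΛ]
    -- The form ⟨U|·⟩ vanishes on a spanning family, hence on `U` itself, against positivity of the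
    -- metric.
    · by_contra hne
      exact (G.pos _ _ hne).ne'
        (hext (G.inner (γ.base t) (U t)).toLinearMap (fun i => hy0 (.inl i)) (U t))
    · ext a b
      exact hext ((Λ t).flip b) (fun i => hext (Λ t (s i (γ.base t)))
        (fun j => hy0 (.inr (i, j))) b) a

theorem SolvesKillingSystem.eq_zero (h : nab.IsLeviCivita G) {γ : A.AdmissibleCurve}
    {U : ∀ t, E (γ.base t)} {Λ : ∀ t, E (γ.base t) →ₗ[ℝ] E (γ.base t) →ₗ[ℝ] ℝ}
    (hsol : nab.SolvesKillingSystem G γ U Λ) (hU : U 0 = 0) (hΛ : Λ 0 = 0) :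
    ∀ t ∈ Icc (0 : ℝ) 1, U t = 0 ∧ Λ t = 0 :=
  forall_mem_Icc_of_isBigO_deriv (P := fun t => U t = 0 ∧ Λ t = 0) ⟨hU, hΛ⟩
    fun _ ht => hsol.exists_components h ht

/-- Solutions of the system are determined by their initial value. -/
theorem SolvesKillingSystem.unique (h : nab.IsLeviCivita G) {γ : A.AdmissibleCurve}
    {U U' : ∀ t, E (γ.base t)} {Λ Λ' : ∀ t, E (γ.base t) →ₗ[ℝ] E (γ.base t) →ₗ[ℝ] ℝ}
    (hsol : nab.SolvesKillingSystem G γ U Λ) (hsol' : nab.SolvesKillingSystem G γ U' Λ')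
    (hU : U 0 = U' 0) (hΛ : Λ 0 = Λ' 0) :
    ∀ t ∈ Icc (0 : ℝ) 1, U t = U' t ∧ Λ t = Λ' t := by
  intro t ht
  have h1 := (hsol.smul_add_smul hsol' 1 (-1)).eq_zero h (by simp [hU])
    (by ext a b; simp [hΛ]) t ht
  refine ⟨by simpa [← sub_eq_add_neg, sub_eq_zero] using h1.1, ?_⟩
  ext a b
  simpa [← sub_eq_add_neg, sub_eq_zero] using congrArg (fun L => L a b) h1.2

end Connection

/-! ### Killing sections as solutions -/

/-- A Killing section and its tensor `L` solve the system along every admissible curve. -/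
theorem IsKilling.solvesKillingSystem {nab : A.Connection}
    {G : ContMDiffRiemannianMetric (𝓡 m) ∞ F E} (h : nab.IsLeviCivita G)
    {u : Cₛ^∞⟮𝓡 m; F, E⟯} (hu : A.IsKilling G u) (γ : A.AdmissibleCurve) :
    nab.SolvesKillingSystem G γ (fun t => u (γ.base t))
      (fun t => nab.lowered G u (γ.base t)) := by
  intro t ht
  refine ⟨⟨nab.D u (γ.base t) (γ.vel t), ⟨1, fun _ _ => 1, fun _ => 0, fun _ => u, ?_, ?_, ?_⟩,
    fun a => rfl⟩, fun y z => ?_⟩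
  · exact Eventually.of_forall fun τ => by simp
  · exact fun _ => hasDerivWithinAt_const _ _ _
  · simp
  · obtain ⟨v, hv⟩ := exists_smoothSection_eq (m := m) (F := F) (γ.vel t)
    have h1 := γ.hasDerivWithinAt_comp (innerFun G (nab.sec y u) z) ht
    refine h1.congr_deriv ?_
    -- The derivative of L(y, z) is ⟨∇_v ∇_y u|z⟩ + L(y, ∇_v z), and `h3` replaces its first term by
    -- L(∇_v y, z) - ⟨R(y, z)u|v⟩.
    have h2 := h.metric v (nab.sec y u) z (γ.base t)
    have h3 := hu.inner_sec_sec h v y z (γ.base t)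
    rw [← nab.curvatureAt_apply] at h3
    simp only [Connection.sec_apply, Connection.lowered_apply, hv] at h2 h3 ⊢
    refine h2.trans ?_
    linarith

end LieAlgebroid

end KillingSections

end

theorem mainTheorem4 {m : ℕ} {M : Type*} [TopologicalSpace M] [T2Space M]
    [ChartedSpace (EuclideanSpace ℝ (Fin m)) M] [IsManifold (𝓡 m) ∞ M]
    {F : Type*} [NormedAddCommGroup F] [NormedSpace ℝ F] [FiniteDimensional ℝ F]
    {E : M → Type*} [∀ x, AddCommGroup (E x)] [∀ x, Module ℝ (E x)]
    [∀ x, TopologicalSpace (E x)] [∀ x, IsTopologicalAddGroup (E x)]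
    [∀ x, ContinuousConstSMul ℝ (E x)] [TopologicalSpace (TotalSpace F E)]
    [FiberBundle F E] [VectorBundle ℝ F E] [ContMDiffVectorBundle ∞ F E (𝓡 m)]
    (A : LieAlgebroid m M F E) (G : ContMDiffRiemannianMetric (𝓡 m) ∞ F E)
    (nab : A.Connection) (hnab : nab.IsLeviCivita G) :
    -- the tensor `L` of a Killing section is antisymmetric
    (∀ u : Cₛ^∞⟮𝓡 m; F, E⟯, A.IsKilling G u → ∀ (x : M) (a b : E x),
      nab.lowered G u x a b = - nab.lowered G u x b a) ∧
    -- the system along an admissible curve is linear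
    (∀ (γ : A.AdmissibleCurve) (U U' : ∀ t, E (γ.base t))
      (Λ Λ' : ∀ t, E (γ.base t) →ₗ[ℝ] E (γ.base t) →ₗ[ℝ] ℝ) (c c' : ℝ),
      nab.SolvesKillingSystem G γ U Λ → nab.SolvesKillingSystem G γ U' Λ' →
      nab.SolvesKillingSystem G γ (fun t => c • U t + c' • U' t)
        (fun t => c • Λ t + c' • Λ' t)) ∧
    -- a Killing section and its tensor `L` solve the system along every admissible curve, and they
    -- are recovered from their value at the initial point by solving it
    (∀ u : Cₛ^∞⟮𝓡 m; F, E⟯, A.IsKilling G u → ∀ γ : A.AdmissibleCurve,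
      nab.SolvesKillingSystem G γ (fun t => u (γ.base t))
        (fun t => nab.lowered G u (γ.base t)) ∧
      ∀ (U : ∀ t, E (γ.base t)) (Λ : ∀ t, E (γ.base t) →ₗ[ℝ] E (γ.base t) →ₗ[ℝ] ℝ),
        nab.SolvesKillingSystem G γ U Λ →
        U 0 = u (γ.base 0) → Λ 0 = nab.lowered G u (γ.base 0) →
        ∀ t ∈ Icc (0 : ℝ) 1,
          U t = u (γ.base t) ∧ Λ t = nab.lowered G u (γ.base t)) ∧
    -- the data at `p` determine a Killing section at every point joined to `p`
    (∀ u u' : Cₛ^∞⟮𝓡 m; F, E⟯, A.IsKilling G u → A.IsKilling G u' → ∀ p : M,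
      u p = u' p → nab.lowered G u p = nab.lowered G u' p →
      (∀ q : M, A.Connects p q → u q = u' q ∧ nab.lowered G u q = nab.lowered G u' q) ∧
      ((∀ q : M, A.Connects p q) → u = u')) := by
  refine ⟨fun u hu => hu.lowered_antisymm hnab, fun γ U U' Λ Λ' c c' h h' =>
    h.smul_add_smul h' c c', fun u hu γ => ⟨hu.solvesKillingSystem hnab γ, fun U Λ hsol hU hΛ =>
    hsol.unique hnab (hu.solvesKillingSystem hnab γ) hU hΛ⟩, fun u u' hu hu' p hp hL => ?_⟩
  have key : ∀ q : M, A.Connects p q →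
      u q = u' q ∧ nab.lowered G u q = nab.lowered G u' q := by
    rintro q ⟨γ, rfl, rfl⟩
    exact (hu.solvesKillingSystem hnab γ).unique hnab (hu'.solvesKillingSystem hnab γ) hp hL 1
      (by simp)
  exact ⟨key, fun hq => ContMDiffSection.ext fun q => (key q (hq q)).1⟩
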